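/- Theorem 1.3. Let $\mathcal L$ be the twisted Heisenberg–Virasoro algebra, i.e. the complex Lie algebra with basis $\{L_m, I_m, C, C_I, C_{LI} \mid m\in\mathbb Z\}$ and relations $$[L_n,L_m]=(m-n)L_{n+m}+\delta_{n,-m}\tfrac{n^3-n}{12}C,\qquad [L_n,I_m]=mI_{n+m}+\delta_{n,-m}(n^2+n)C_{LI},$$ $$[I_n,I_m]=n\,\delta_{n,-m}C_I,\qquad [\mathcal L,C]=[\mathcal L,C_I]=[\mathcal L,C_{LI}]=0 .$$ A weight module over $\mathcal L$ is an $\mathcal L$-module that is diagonalizable over $\mathfrak H=\mathrm{Span}_{\mathbb C}\{L_0,I_0,C,C_{LI},C_I\}$. For $\lambda\in\mathbb C$ put $M_\lambda=\{v\in M\mid L_0v=\lambda v\}$, and let $\mathrm{Supp}(M)=\{\lambda\in\mathbb C\mid M_\lambda\neq 0\}$. Let $M$ be an irreducible weight $\mathcal L$-module, and assume that there is $\lambda\in\mathbb C$ such that $\dim M_\lambda=\infty$. Then $\mathrm{Supp}(M)=\lambda+\mathbb Z$, and $\dim M_{\lambda+k}=\infty$ for every $k\in\mathbb Z$. -/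

import Mathlib

/-- Labels for the standard basis `{L_m, I_m, C, C_I, C_{LI} | m ∈ ℤ}` of the twisted
Heisenberg-Virasoro algebra. -/
inductive THVIndex : Type
  | L (m : ℤ)
  | I (m : ℤ)
  | C
  | CI
  | CLI

/-- The underlying vector space of the twisted Heisenberg-Virasoro algebra: the complex vector
space with basis `{L_m, I_m, C, C_I, C_{LI} | m ∈ ℤ}`. -/
def TwistedHV : Type := THVIndex →₀ ℂ

namespace TwistedHV

noncomputable instance : AddCommGroup TwistedHV :=
  inferInstanceAs (AddCommGroup (THVIndex →₀ ℂ))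

noncomputable instance : Module ℂ TwistedHV :=
  inferInstanceAs (Module ℂ (THVIndex →₀ ℂ))

/-- The basis vector with a given label. -/
noncomputable def gen (i : THVIndex) : TwistedHV := Finsupp.single i (1 : ℂ)

/-- The basis vector `L_m`. -/
noncomputable def L (m : ℤ) : TwistedHV := gen (THVIndex.L m)

/-- The basis vector `I_m`. -/
noncomputable def I (m : ℤ) : TwistedHV := gen (THVIndex.I m)

/-- The basis vector `C`. -/
noncomputable def C : TwistedHV := gen THVIndex.C

/-- The basis vector `C_I`. -/
noncomputable def CI : TwistedHV := gen THVIndex.CI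

/-- The basis vector `C_{LI}`. -/
noncomputable def CLI : TwistedHV := gen THVIndex.CLI

/-- The bracket of two basis vectors:
`[L_n, L_m] = (m - n) L_{n+m} + δ_{n,-m} (n³ - n)/12 C`,
`[L_n, I_m] = m I_{n+m} + δ_{n,-m} (n² + n) C_{LI}` (and `[I_m, L_n] = -[L_n, I_m]`),
`[I_n, I_m] = n δ_{n,-m} C_I`, and `C`, `C_I`, `C_{LI}` are central.
The Kronecker symbol `δ_{n,-m}` is written as a case distinction on `n + m = 0`. -/
noncomputable def genBracket : THVIndex → THVIndex → TwistedHV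
  | .L n, .L m =>
      ((m : ℂ) - (n : ℂ)) • L (n + m) + (if n + m = 0 then (((n : ℂ) ^ 3 - n) / 12) else 0) • C
  | .L n, .I m => (m : ℂ) • I (n + m) + (if n + m = 0 then ((n : ℂ) ^ 2 + n) else 0) • CLI
  | .I m, .L n => -((m : ℂ) • I (n + m) + (if n + m = 0 then ((n : ℂ) ^ 2 + n) else 0) • CLI)
  | .I n, .I m => (if n + m = 0 then (n : ℂ) else 0) • CI
  | _, _ => 0

/-- The bilinear extension of `genBracket`. -/
noncomputable def bracketBilin : TwistedHV →ₗ[ℂ] TwistedHV →ₗ[ℂ] TwistedHV :=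
  Finsupp.linearCombination ℂ (fun i : THVIndex =>
    (Finsupp.linearCombination ℂ (genBracket i) : (THVIndex →₀ ℂ) →ₗ[ℂ] TwistedHV))

noncomputable instance : Bracket TwistedHV TwistedHV := ⟨fun x y => bracketBilin x y⟩

theorem lie_def (x y : TwistedHV) : ⁅x, y⁆ = bracketBilin x y := rfl

theorem bracketBilin_gen (i j : THVIndex) : bracketBilin (gen i) (gen j) = genBracket i j := by
  have h : bracketBilin (gen i) =
      (Finsupp.linearCombination ℂ (genBracket i) : (THVIndex →₀ ℂ) →ₗ[ℂ] TwistedHV) := by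
    exact (Finsupp.linearCombination_single ℂ (1 : ℂ) i).trans (one_smul ℂ _)
  rw [h]
  exact (Finsupp.linearCombination_single ℂ (1 : ℂ) j).trans (one_smul ℂ _)

/-- Linear maps out of the algebra are determined by their values on the basis. -/
theorem linearMap_ext {V : Type*} [AddCommGroup V] [Module ℂ V] {f g : TwistedHV →ₗ[ℂ] V}
    (h : ∀ i, f (gen i) = g (gen i)) : f = g :=
  Finsupp.lhom_ext' (R := ℂ) (M := ℂ) (α := THVIndex) (φ := f) (ψ := g)
    (fun i => LinearMap.ext_ring (h i))

theorem genBracket_skew (i j : THVIndex) : genBracket i j = -genBracket j i := by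
  cases i <;> cases j <;> simp only [genBracket, neg_neg, neg_zero]
  case L.L n m =>
    by_cases h : n + m = 0
    · obtain rfl : n = -m := by omega
      simp [add_comm]
      module
    · have h' : ¬ m + n = 0 := fun e => h (by omega)
      simp only [h, if_false, add_comm m n]
      module
  case I.I n m =>
    by_cases h : n + m = 0
    · obtain rfl : n = -m := by omega
      simp
    · have h' : ¬ m + n = 0 := fun e => h (by omega)
      simp [h, h']

theorem bracketBilin_skew (x y : TwistedHV) : bracketBilin x y = -bracketBilin y x := by
  have h : bracketBilin = -bracketBilin.flip := by
    refine linearMap_ext fun i => linearMap_ext fun j => ?_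
    simp only [LinearMap.neg_apply, LinearMap.flip_apply, bracketBilin_gen]
    exact genBracket_skew i j
  exact congrArg (fun f => f x y) h

theorem jacobi_gen (i j k : THVIndex) :
    bracketBilin (gen i) (genBracket j k) =
      bracketBilin (genBracket i j) (gen k) + bracketBilin (gen j) (genBracket i k) := by
  cases i <;> cases j <;> cases k <;>
    simp only [genBracket, L, I, C, CI, CLI, map_add, map_smul, map_neg, map_zero,
      LinearMap.add_apply, LinearMap.smul_apply, LinearMap.neg_apply, LinearMap.zero_apply,
      bracketBilin_gen, smul_zero, add_zero, zero_add, neg_zero]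
  all_goals rename_i n m k
  all_goals
    obtain ⟨s, hs⟩ : ∃ s : ℤ, s = n + m + k := ⟨_, rfl⟩
    simp only [show n + (m + k) = s by omega, show n + (k + m) = s by omega,
      show m + (n + k) = s by omega, show m + (k + n) = s by omega,
      show k + (n + m) = s by omega, show k + (m + n) = s by omega,
      show n + m + k = s by omega, show n + k + m = s by omega,
      show m + n + k = s by omega, show m + k + n = s by omega]
    by_cases h : s = 0
    · have hk : (k : ℂ) = -n - m := by
        rw [show k = -n - m by omega]
        push_cast
        ring
      simp only [h, if_true, Int.cast_add, hk]
      module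
    · simp only [h, if_false, Int.cast_add]
      module

/-- Induction along the basis. -/
theorem induction_gen {p : TwistedHV → Prop} (zero : p 0)
    (add : ∀ x y, p x → p y → p (x + y)) (smul : ∀ (c : ℂ) x, p x → p (c • x))
    (gen : ∀ i, p (gen i)) (x : TwistedHV) : p x := by
  refine Finsupp.induction_linear (motive := p) x zero add fun i c => ?_
  have h : (Finsupp.single i c : THVIndex →₀ ℂ) = c • Finsupp.single i (1 : ℂ) := by simp
  rw [h]
  exact smul c _ (gen i)

theorem bracketBilin_jacobi (x y z : TwistedHV) :
    bracketBilin x (bracketBilin y z) =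
      bracketBilin (bracketBilin x y) z + bracketBilin y (bracketBilin x z) := by
  induction x using induction_gen with
  | zero => simp
  | add x₁ x₂ h₁ h₂ => simp only [map_add, LinearMap.add_apply, h₁, h₂]; abel
  | smul c x h => simp only [map_smul, LinearMap.smul_apply, h, smul_add]
  | gen i =>
    induction y using induction_gen with
    | zero => simp
    | add x₁ x₂ h₁ h₂ => simp only [map_add, LinearMap.add_apply, h₁, h₂]; abel
    | smul c x h => simp only [map_smul, LinearMap.smul_apply, h, smul_add]
    | gen j =>
      induction z using induction_gen with
      | zero => simp
      | add x₁ x₂ h₁ h₂ => simp only [map_add, h₁, h₂]; abel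
      | smul c x h => simp only [map_smul, h, smul_add]
      | gen k =>
        simp only [bracketBilin_gen]
        exact jacobi_gen i j k

/-- The Lie ring structure of the twisted Heisenberg-Virasoro algebra. -/
noncomputable instance : LieRing TwistedHV where
  add_lie x y z := by simp only [lie_def, map_add, LinearMap.add_apply]
  lie_add x y z := by simp only [lie_def, map_add]
  lie_self x := by
    have h : bracketBilin x x = -bracketBilin x x := bracketBilin_skew x x
    have h2 : (2 : ℂ) • bracketBilin x x = 0 := by
      rw [two_smul]
      nth_rewrite 1 [h]
      exact neg_add_cancel _
    exact (smul_eq_zero.mp h2).resolve_left two_ne_zero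
  leibniz_lie x y z := bracketBilin_jacobi x y z

/-- The twisted Heisenberg-Virasoro algebra is a complex Lie algebra. -/
noncomputable instance : LieAlgebra ℂ TwistedHV where
  lie_smul c x y := by simp only [lie_def, map_smul]

/-- The defining relations, on the basis. -/
theorem lie_gen_gen (i j : THVIndex) : ⁅gen i, gen j⁆ = genBracket i j := bracketBilin_gen i j

/-- The Cartan subalgebra `𝔥 = Span {L_0, I_0, C, C_{LI}, C_I}`. -/
noncomputable def cartan : Submodule ℂ TwistedHV :=
  Submodule.span ℂ {L 0, I 0, C, CLI, CI}

section Modules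

variable (M : Type*) [AddCommGroup M] [Module ℂ M] [LieRingModule TwistedHV M]
  [LieModule ℂ TwistedHV M]

/-- The simultaneous eigenspace of the Cartan subalgebra `𝔥` for a linear functional `χ` on `𝔥`:
all `v ∈ M` with `h v = χ(h) v` for every `h ∈ 𝔥`. -/
noncomputable def cartanEigenspace (χ : cartan →ₗ[ℂ] ℂ) : Submodule ℂ M :=
  ⨅ h : cartan, Module.End.eigenspace (LieModule.toEnd ℂ TwistedHV M (h : TwistedHV)) (χ h)

/-- A weight module is an `𝔥`-diagonalizable module: it is spanned by the simultaneous
eigenspaces of `𝔥`. -/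
def IsWeightModule : Prop := ⨆ χ : cartan →ₗ[ℂ] ℂ, cartanEigenspace M χ = ⊤

/-- The weight space `M_lam = {v ∈ M | L_0 v = lam v}`. -/
noncomputable def weightSpace (lam : ℂ) : Submodule ℂ M :=
  Module.End.eigenspace (LieModule.toEnd ℂ TwistedHV M (L 0)) lam

/-- The support `Supp(M) = {lam ∈ ℂ | M_lam ≠ 0}`. -/
def supp : Set ℂ := {lam | weightSpace M lam ≠ ⊥}

end Modules

end TwistedHV

/-!
Let `W k` be the eigenspace of `L_0` on `M` for the eigenvalue `lam + k`. The elements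
`I_0, C, C_I, C_{LI}` are central in the algebra, so on an irreducible weight module they act by
scalars, and `M` is the direct sum of the `W k`. The theorem says that the `W k` are all
finite-dimensional or all infinite-dimensional. By the symmetry `n ↦ -n` it is enough that `W m` is
finite-dimensional whenever `W (m + 1)` is (`GradedHVModule.finiteDimensional_of_succ`).

Suppose that `W m` is infinite-dimensional and `W (m + 1)` is finite-dimensional. Any finite list of
operators of degree one has a common nonzero kernel vector `v ∈ W m`. No nonzero vector is killed by
`L_1, L_2, I_1`: it would be a highest weight vector, and a module generated by such a vector has
finite-dimensional weight spaces (`GradedHVModule.finiteDimensional_of_highest`). In particular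
`w = L_2 v` and, by symmetry, `u = L_{-2} w` are nonzero as soon as `v` is killed by
`L_1, I_1, L_{-1} L_2, I_{-1} L_2`. The argument then has two steps.

* *The `I_n` act by zero* (`GradedHVModule.i_apply_eq_zero`). All `I_n` with `n ≠ 0` kill `w`, and
  those with `n < 0` kill `u` as well. Evaluating `[L_1, I_{-1}]` and `[L_2, I_{-2}]` on `u` shows
  that `I_0` and `C_{LI}` act by zero. Then the common kernel of the `I_n` is a submodule, which
  contains `w`.
* *The Virasoro algebra* (`GradedHVModule.finiteDimensional_of_i_eq_zero`). Put `a = lam + m`. From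
  `L_1 v = L_{-1} L_2 v = 0` follows `L_j L_{-1} v = 2 a L_{j-1} v` for `j ≥ 2`, and commuting `L_2`
  with `L_{j+1}` on `L_{-1} v` gives `L_2 L_j v = (j - 1) L_{j+2} v` if `a ≠ 0`. A further relation,
  `(2 a + 2) L_3 v = 0`, leaves only `a = 0` and `a = -1`; the same argument for `w` and the opposite
  direction gives `a + 2 = 0` or `a + 2 = 1`, so that `a = -1`. Now the vectors `L_j v` and `L_{-j} w`
  with `j ≥ 2` span a submodule with weight spaces of dimension at most one, as in the module of
  functions modulo constants. By irreducibility it is everything, a contradiction.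
-/

/-! ### Infinite-dimensional subspaces -/

/-- An infinite-dimensional subspace meets the kernel of a map into a finite-dimensional space in an
infinite-dimensional subspace. -/
theorem not_finiteDimensional_inf_ker {V : Type*} [AddCommGroup V] [Module ℂ V]
    {K B : Submodule ℂ V} (hK : ¬ FiniteDimensional ℂ K) (hB : FiniteDimensional ℂ B)
    (f : Module.End ℂ V) (hf : ∀ x ∈ K, f x ∈ B) :
    ¬ FiniteDimensional ℂ (K ⊓ LinearMap.ker f : Submodule ℂ V) := by
  intro h
  refine hK ((Submodule.fg_iff_finiteDimensional K).mp ?_)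
  refine Submodule.fg_of_fg_map_of_fg_inf_ker f ?_ ((Submodule.fg_iff_finiteDimensional _).mpr h)
  have : K.map f ≤ B := by rintro _ ⟨x, hx, rfl⟩; exact hf x hx
  exact (Submodule.fg_iff_finiteDimensional _).mpr (Submodule.finiteDimensional_of_le this)

/-! ### Graded modules -/

/-- The operators by which the twisted Heisenberg-Virasoro algebra acts on an irreducible weight
module, recorded in a form that is symmetric under `n ↦ -n`. The central elements are replaced by
scalars. In particular `I_0` does not appear: `i 0` is set to be zero, and the scalar of `I_0` is
absorbed into the cocycle `p n + q n ^ 2` of `[l n, i (-n)]`. -/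
structure GradedHVModule (V : Type*) [AddCommGroup V] [Module ℂ V] where
  /-- The action of `L_n`. -/
  l : ℤ → Module.End ℂ V
  /-- The action of `I_n` for `n ≠ 0`; zero for `n = 0`. -/
  i : ℤ → Module.End ℂ V
  /-- The homogeneous component of degree `k`, on which `L_0` acts by `wt + k`. -/
  W : ℤ → Submodule ℂ V
  /-- The eigenvalue of `L_0` in degree zero. -/
  wt : ℂ
  /-- The scalar of `C`. -/
  c : ℂ
  /-- The scalar of `C_I`. -/
  d : ℂ
  /-- The linear coefficient of the cocycle of `[l n, i (-n)]`. -/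
  p : ℂ
  /-- The quadratic coefficient of that cocycle. -/
  q : ℂ
  i_zero : ∀ x, i 0 x = 0
  l_zero : ∀ k, ∀ x ∈ W k, l 0 x = (wt + (k : ℂ)) • x
  l_mem : ∀ n j k, j + n = k → ∀ x ∈ W j, l n x ∈ W k
  i_mem : ∀ n j k, j + n = k → ∀ x ∈ W j, i n x ∈ W k
  l_l : ∀ n m x, l n (l m x) = l m (l n x) + ((m : ℂ) - (n : ℂ)) • l (n + m) x +
    (if n + m = 0 then ((n : ℂ) ^ 3 - n) / 12 * c else 0) • x
  l_i : ∀ n m x, l n (i m x) = i m (l n x) + (m : ℂ) • i (n + m) x +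
    (if n + m = 0 then p * n + q * (n : ℂ) ^ 2 else 0) • x
  i_i : ∀ n m x, i n (i m x) = i m (i n x) + (if n + m = 0 then (n : ℂ) * d else 0) • x
  /-- Irreducibility, for graded submodules `F`. -/
  irr : ∀ F : ℤ → Submodule ℂ V, (∀ k, F k ≤ W k) →
    (∀ n j k, j + n = k → ∀ x ∈ F j, l n x ∈ F k) →
    (∀ n j k, j + n = k → ∀ x ∈ F j, i n x ∈ F k) →
    (∃ k, F k ≠ ⊥) → ∀ k, F k = W k

namespace GradedHVModule

variable {V : Type*} [AddCommGroup V] [Module ℂ V] (R : GradedHVModule V)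

/-- The graded module obtained by twisting with `L_n ↦ -L_{-n}`, `I_n ↦ I_{-n}`, which reverses the
grading. -/
def mirror : GradedHVModule V where
  l n := -R.l (-n)
  i n := R.i (-n)
  W k := R.W (-k)
  wt := -R.wt
  c := -R.c
  d := -R.d
  p := R.p
  q := -R.q
  i_zero x := by simpa using R.i_zero x
  l_zero k x hx := by
    have h := R.l_zero (-k) x hx
    simp only [neg_zero, LinearMap.neg_apply, h]
    push_cast
    module
  l_mem n j k h x hx := neg_mem (R.l_mem (-n) (-j) (-k) (by omega) x hx)
  i_mem n j k h x hx := R.i_mem (-n) (-j) (-k) (by omega) x hx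
  l_l n m x := by
    have h := R.l_l (-n) (-m) x
    simp only [show -n + -m = -(n + m) by ring, neg_eq_zero] at h
    simp only [LinearMap.neg_apply, map_neg, neg_neg, h]
    split_ifs <;> push_cast <;> module
  l_i n m x := by
    have h := R.l_i (-n) (-m) x
    simp only [show -n + -m = -(n + m) by ring, neg_eq_zero] at h
    simp only [LinearMap.neg_apply, map_neg, h]
    split_ifs <;> push_cast <;> module
  i_i n m x := by
    have h := R.i_i (-n) (-m) x
    have e : (-n + -m = 0) ↔ (n + m = 0) := by omega
    simp only [e] at h
    simp only [h]
    split_ifs <;> push_cast <;> module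
  irr F h₁ h₂ h₃ h₄ k := by
    have := R.irr (fun k => F (-k)) (fun k => by simpa using h₁ (-k))
      (fun n j k h x hx => by
        simpa using h₂ (-n) (-j) (-k) (by omega) x hx)
      (fun n j k h x hx => by
        simpa using h₃ (-n) (-j) (-k) (by omega) x hx)
      (by obtain ⟨k, hk⟩ := h₄; exact ⟨-k, by simpa using hk⟩) (-k)
    simpa using this

theorem mirror_W_neg (k : ℤ) : R.mirror.W (-k) = R.W k := congrArg R.W (neg_neg k)

/-! ### Stability under a generating set -/

/-- `L_1` and `L_2` generate all `L_n` with `n ≥ 1`. -/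
theorem l_mem_of_gen_pos {F : ℤ → Submodule ℂ V}
    (h₁ : ∀ j k, j + 1 = k → ∀ x ∈ F j, R.l 1 x ∈ F k)
    (h₂ : ∀ j k, j + 2 = k → ∀ x ∈ F j, R.l 2 x ∈ F k) (n : ℤ) (hn : 1 ≤ n) :
    ∀ j k, j + n = k → ∀ x ∈ F j, R.l n x ∈ F k := by
  rcases hn.eq_or_lt with rfl | hn
  · exact h₁
  replace hn : 2 ≤ n := hn
  induction n, hn using Int.leInduction with
  | base => exact h₂
  | succ n hn' ih =>
    intro j k hjk x hx
    specialize ih (by omega)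
    have h := R.l_l 1 n x
    rw [if_neg (by omega), zero_smul, add_zero, add_comm (1 : ℤ) n] at h
    have hc : ((n : ℂ) - (1 : ℤ)) ≠ 0 := by
      rw [sub_ne_zero]; exact_mod_cast (by omega : n ≠ 1)
    rw [← (F k).smul_mem_iff hc, ← sub_eq_iff_eq_add'.mpr h]
    exact sub_mem (h₁ (j + n) k (by omega) _ (ih _ _ rfl x hx))
      (ih (j + 1) k (by omega) _ (h₁ _ _ rfl x hx))

/-- `L_1` and `I_1` generate all `I_n` with `n ≥ 1`. -/
theorem i_mem_of_gen_pos {F : ℤ → Submodule ℂ V}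
    (h₁ : ∀ j k, j + 1 = k → ∀ x ∈ F j, R.l 1 x ∈ F k)
    (h₂ : ∀ j k, j + 1 = k → ∀ x ∈ F j, R.i 1 x ∈ F k) (n : ℤ) (hn : 1 ≤ n) :
    ∀ j k, j + n = k → ∀ x ∈ F j, R.i n x ∈ F k := by
  induction n, hn using Int.leInduction with
  | base => exact h₂
  | succ n hn' ih =>
    intro j k hjk x hx
    have h := R.l_i 1 n x
    rw [if_neg (by omega), zero_smul, add_zero, add_comm (1 : ℤ) n] at h
    have hc : (n : ℂ) ≠ 0 := by exact_mod_cast (by omega : n ≠ 0)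
    rw [← (F k).smul_mem_iff hc, ← sub_eq_iff_eq_add'.mpr h]
    exact sub_mem (h₁ (j + n) k (by omega) _ (ih _ _ rfl x hx))
        (ih (j + 1) k (by omega) _ (h₁ _ _ rfl x hx))

/-- It suffices to check the stability of a graded subspace for the generators
`L_{±1}, L_{±2}, I_{±1}`. -/
theorem eq_W_of_gen {F : ℤ → Submodule ℂ V} (hF : ∀ k, F k ≤ R.W k)
    (h₁ : ∀ j k, j + 1 = k → ∀ x ∈ F j, R.l 1 x ∈ F k)
    (h₂ : ∀ j k, j + 2 = k → ∀ x ∈ F j, R.l 2 x ∈ F k)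
    (h₃ : ∀ j k, j + 1 = k → ∀ x ∈ F j, R.i 1 x ∈ F k)
    (h₄ : ∀ j k, j + -1 = k → ∀ x ∈ F j, R.l (-1) x ∈ F k)
    (h₅ : ∀ j k, j + -2 = k → ∀ x ∈ F j, R.l (-2) x ∈ F k)
    (h₆ : ∀ j k, j + -1 = k → ∀ x ∈ F j, R.i (-1) x ∈ F k)
    (hne : ∃ k, F k ≠ ⊥) (k : ℤ) : F k = R.W k := by
  have e₁ : ∀ j k, j + 1 = k → ∀ x ∈ F (-j), R.mirror.l 1 x ∈ F (-k) := fun j k hjk x hx =>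
    neg_mem (h₄ (-j) (-k) (by omega) x hx)
  have e₂ : ∀ j k, j + 2 = k → ∀ x ∈ F (-j), R.mirror.l 2 x ∈ F (-k) := fun j k hjk x hx =>
    neg_mem (h₅ (-j) (-k) (by omega) x hx)
  have e₃ : ∀ j k, j + 1 = k → ∀ x ∈ F (-j), R.mirror.i 1 x ∈ F (-k) := fun j k hjk x hx =>
    h₆ (-j) (-k) (by omega) x hx
  refine R.irr F hF (fun n j k hjk x hx => ?_) (fun n j k hjk x hx => ?_) hne k
  · rcases lt_trichotomy n 0 with hn | rfl | hn
    · have := R.mirror.l_mem_of_gen_pos (F := fun k => F (-k)) e₁ e₂ (-n) (by omega) (-j) (-k)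
        (by omega) x (by simpa using hx)
      simpa [mirror] using this
    · obtain rfl : j = k := by omega
      rw [R.l_zero j x (hF j hx)]
      exact (F j).smul_mem _ hx
    · exact R.l_mem_of_gen_pos h₁ h₂ n (by omega) j k hjk x hx
  · rcases lt_trichotomy n 0 with hn | rfl | hn
    · have := R.mirror.i_mem_of_gen_pos (F := fun k => F (-k)) e₁ e₃ (-n) (by omega) (-j) (-k)
        (by omega) x (by simpa using hx)
      simpa [mirror] using this
    · rw [R.i_zero]
      exact zero_mem _
    · exact R.i_mem_of_gen_pos h₁ h₃ n (by omega) j k hjk x hx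

/-! ### Highest weight vectors -/

/-- The submodule generated by a highest weight vector `x`, as a sequence of homogeneous
pieces: `hwSpace x (n + 2)` is the span of the monomials of degree `-n` in `L_{-1}, L_{-2}, I_{-1}`
applied to `x`. The shift by two makes room for the zero pieces in degrees `1` and `2` above `x`,
which are the targets of `L_1, L_2, I_1` on the topmost pieces. -/
def hwSpace (x : V) : ℕ → Submodule ℂ V
  | 0 => ⊥
  | 1 => ⊥
  | 2 => ℂ ∙ x
  | n + 3 => (hwSpace x (n + 2)).map (R.l (-1)) ⊔ (hwSpace x (n + 2)).map (R.i (-1)) ⊔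
      (hwSpace x (n + 1)).map (R.l (-2))

instance finiteDimensional_hwSpace (x : V) (n : ℕ) : FiniteDimensional ℂ (R.hwSpace x n) := by
  induction n using Nat.strong_induction_on with
  | _ n ih =>
    match n, ih with
    | 0, _ => exact inferInstanceAs (FiniteDimensional ℂ (⊥ : Submodule ℂ V))
    | 1, _ => exact inferInstanceAs (FiniteDimensional ℂ (⊥ : Submodule ℂ V))
    | 2, _ => exact inferInstanceAs (FiniteDimensional ℂ (ℂ ∙ x))
    | n + 3, ih =>
      have := ih (n + 2) (by omega)
      have := ih (n + 1) (by omega)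
      rw [hwSpace]; infer_instance

theorem hwSpace_le {x : V} {k : ℤ} (hx : x ∈ R.W k) (n : ℕ) :
    R.hwSpace x n ≤ R.W (k + 2 - n) := by
  induction n using Nat.strong_induction_on with
  | _ n ih =>
    match n, ih with
    | 0, _ => exact bot_le
    | 1, _ => exact bot_le
    | 2, _ => simpa [hwSpace] using hx
    | n + 3, ih =>
      have h₂ := ih (n + 2) (by omega)
      have h₁ := ih (n + 1) (by omega)
      unfold hwSpace
      refine sup_le (sup_le ?_ ?_) ?_ <;> rw [Submodule.map_le_iff_le_comap] <;> intro y hy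
      · exact R.l_mem _ _ _ (by push_cast; ring) y (h₂ hy)
      · exact R.i_mem _ _ _ (by push_cast; ring) y (h₂ hy)
      · exact R.l_mem _ _ _ (by push_cast; ring) y (h₁ hy)

theorem l_neg_one_mem_hwSpace {x y : V} (n : ℕ) (hy : y ∈ R.hwSpace x n) :
    R.l (-1) y ∈ R.hwSpace x (n + 1) := by
  match n, hy with
  | 0, hy => simp [(Submodule.mem_bot ℂ).mp hy]
  | 1, hy => simp [(Submodule.mem_bot ℂ).mp hy]
  | n + 2, hy => exact Submodule.mem_sup_left (Submodule.mem_sup_left ⟨y, hy, rfl⟩)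

theorem i_neg_one_mem_hwSpace {x y : V} (n : ℕ) (hy : y ∈ R.hwSpace x n) :
    R.i (-1) y ∈ R.hwSpace x (n + 1) := by
  match n, hy with
  | 0, hy => simp [(Submodule.mem_bot ℂ).mp hy]
  | 1, hy => simp [(Submodule.mem_bot ℂ).mp hy]
  | n + 2, hy => exact Submodule.mem_sup_left (Submodule.mem_sup_right ⟨y, hy, rfl⟩)

theorem l_neg_two_mem_hwSpace {x y : V} (n : ℕ) (hy : y ∈ R.hwSpace x n) :
    R.l (-2) y ∈ R.hwSpace x (n + 2) := by
  match n, hy with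
  | 0, hy => simp [(Submodule.mem_bot ℂ).mp hy]
  | n + 1, hy => exact Submodule.mem_sup_right ⟨y, hy, rfl⟩

/-- The positive generators map the pieces of `hwSpace` to one another: they are moved to the right
past the negative ones, by induction on the degree. -/
theorem hwSpace_pos {x : V} {k : ℤ} (hx : x ∈ R.W k) (h₁ : R.l 1 x = 0) (h₂ : R.l 2 x = 0)
    (h₃ : R.i 1 x = 0) (n : ℕ) :
    (∀ y ∈ R.hwSpace x (n + 1), R.l 1 y ∈ R.hwSpace x n) ∧
    (∀ y ∈ R.hwSpace x (n + 1), R.i 1 y ∈ R.hwSpace x n) ∧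
    (∀ y ∈ R.hwSpace x (n + 2), R.l 2 y ∈ R.hwSpace x n) := by
  have hW : ∀ n, ∀ y ∈ R.hwSpace x n, R.l 0 y ∈ R.hwSpace x n := fun n y hy => by
    rw [R.l_zero _ y (R.hwSpace_le hx n hy)]
    exact Submodule.smul_mem _ _ hy
  -- The truncated subtraction is harmless: the pieces with index `0` and `1` vanish.
  suffices H : ∀ n, ∀ y ∈ R.hwSpace x n, R.l 1 y ∈ R.hwSpace x (n - 1) ∧
      R.i 1 y ∈ R.hwSpace x (n - 1) ∧ R.l 2 y ∈ R.hwSpace x (n - 2) from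
    ⟨fun y hy => (H _ y hy).1, fun y hy => (H _ y hy).2.1, fun y hy => (H _ y hy).2.2⟩
  intro n
  induction n using Nat.strong_induction_on with
  | _ n ih =>
    match n, ih with
    | 0, _ => intro y hy; simp [(Submodule.mem_bot ℂ).mp hy]
    | 1, _ => intro y hy; simp [(Submodule.mem_bot ℂ).mp hy]
    | 2, _ =>
      intro y hy
      obtain ⟨r, rfl⟩ := Submodule.mem_span_singleton.mp hy
      simp [h₁, h₂, h₃]
    | n + 3, ih =>
      have i₂ := ih (n + 2) (by omega)
      have i₁ := ih (n + 1) (by omega)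
      clear ih
      simp only [Nat.add_sub_cancel, show n + 3 - 1 = n + 2 by omega,
        show n + 3 - 2 = n + 1 by omega, show n + 2 - 1 = n + 1 by omega,
        show n + 1 - 2 = n - 1 by omega] at *
      suffices H : R.hwSpace x (n + 3) ≤ (R.hwSpace x (n + 2)).comap (R.l 1) ⊓
          (R.hwSpace x (n + 2)).comap (R.i 1) ⊓ (R.hwSpace x (n + 1)).comap (R.l 2) from
        fun y hy => ⟨(H hy).1.1, (H hy).1.2, (H hy).2⟩
      rw [hwSpace]
      have up : ∀ y ∈ R.hwSpace x (n - 1), R.l (-2) y ∈ R.hwSpace x (n + 1) := by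
        rcases n with _ | n
        · intro y hy; simp [(Submodule.mem_bot ℂ).mp hy]
        · exact fun y hy => R.l_neg_two_mem_hwSpace n hy
      refine sup_le (sup_le ?_ ?_) ?_ <;> rw [Submodule.map_le_iff_le_comap] <;> intro y hy
      · obtain ⟨a₁, a₂, a₃⟩ := i₂ y hy
        refine ⟨⟨?_, ?_⟩, ?_⟩ <;> change _ ∈ R.hwSpace x _
        · rw [R.l_l]
          exact add_mem (add_mem (R.l_neg_one_mem_hwSpace _ a₁) (Submodule.smul_mem _ _ (hW _ _ hy)))
            (Submodule.smul_mem _ _ hy)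
        · have h := R.l_i (-1) 1 y
          rw [show (-1 : ℤ) + 1 = 0 by norm_num, R.i_zero, smul_zero, add_zero] at h
          rw [← sub_eq_iff_eq_add.mpr h]
          exact sub_mem (R.l_neg_one_mem_hwSpace _ a₂) (Submodule.smul_mem _ _ hy)
        · rw [R.l_l, show (2 : ℤ) + -1 = 1 by norm_num, if_neg (by norm_num), zero_smul, add_zero]
          exact add_mem (R.l_neg_one_mem_hwSpace _ a₃) (Submodule.smul_mem _ _ a₁)
      · obtain ⟨a₁, a₂, a₃⟩ := i₂ y hy
        refine ⟨⟨?_, ?_⟩, ?_⟩ <;> change _ ∈ R.hwSpace x _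
        · rw [R.l_i, show (1 : ℤ) + -1 = 0 by norm_num, R.i_zero, smul_zero, add_zero]
          exact add_mem (R.i_neg_one_mem_hwSpace _ a₁) (Submodule.smul_mem _ _ hy)
        · rw [R.i_i]
          exact add_mem (R.i_neg_one_mem_hwSpace _ a₂) (Submodule.smul_mem _ _ hy)
        · rw [R.l_i, show (2 : ℤ) + -1 = 1 by norm_num, if_neg (by norm_num), zero_smul, add_zero]
          exact add_mem (R.i_neg_one_mem_hwSpace _ a₃) (Submodule.smul_mem _ _ a₂)
      · obtain ⟨a₁, a₂, a₃⟩ := i₁ y hy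
        refine ⟨⟨?_, ?_⟩, ?_⟩ <;> change _ ∈ R.hwSpace x _
        · rw [R.l_l, show (1 : ℤ) + -2 = -1 by norm_num, if_neg (by norm_num), zero_smul, add_zero]
          exact add_mem (R.l_neg_two_mem_hwSpace _ a₁)
            (Submodule.smul_mem _ _ (R.l_neg_one_mem_hwSpace _ hy))
        · have h := R.l_i (-2) 1 y
          rw [show (-2 : ℤ) + 1 = -1 by norm_num, if_neg (by norm_num), zero_smul, add_zero] at h
          rw [← sub_eq_iff_eq_add.mpr h]
          exact sub_mem (R.l_neg_two_mem_hwSpace _ a₂)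
            (Submodule.smul_mem _ _ (R.i_neg_one_mem_hwSpace _ hy))
        · rw [R.l_l]
          exact add_mem (add_mem (up _ a₃) (Submodule.smul_mem _ _ (hW _ _ hy)))
            (Submodule.smul_mem _ _ hy)

/-- An irreducible module with a highest weight vector has finite-dimensional weight spaces. -/
theorem finiteDimensional_of_highest {x : V} {k : ℤ} (hx : x ∈ R.W k) (hx0 : x ≠ 0)
    (h₁ : R.l 1 x = 0) (h₂ : R.l 2 x = 0) (h₃ : R.i 1 x = 0) (j : ℤ) :
    FiniteDimensional ℂ (R.W j) := by
  have hpos := R.hwSpace_pos hx h₁ h₂ h₃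
  let F : ℤ → Submodule ℂ V := fun j => R.hwSpace x (k + 2 - j).toNat
  have bot : ∀ j, k < j → F j = ⊥ := fun j hj => by
    have : (k + 2 - j).toNat = 0 ∨ (k + 2 - j).toNat = 1 := by omega
    rcases this with h | h <;> simp only [F, h, hwSpace]
  have key : ∀ j, F j = R.W j := by
    refine R.eq_W_of_gen (F := F) (fun j => ?_) ?_ ?_ ?_ ?_ ?_ ?_ ⟨k, ?_⟩
    · by_cases hj : k < j
      · rw [bot j hj]; exact bot_le
      · have := R.hwSpace_le hx (k + 2 - j).toNat
        rwa [show k + 2 - (((k + 2 - j).toNat : ℕ) : ℤ) = j by omega] at this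
    all_goals try intro i j hij y hy
    all_goals try (by_cases hi : k < i <;> [
      (rw [bot i hi, Submodule.mem_bot] at hy; rw [hy, map_zero]; exact zero_mem _); skip])
    · refine (hpos (k + 2 - j).toNat).1 y ?_
      rwa [show (k + 2 - j).toNat + 1 = (k + 2 - i).toNat by omega]
    · refine (hpos (k + 2 - j).toNat).2.2 y ?_
      rwa [show (k + 2 - j).toNat + 2 = (k + 2 - i).toNat by omega]
    · refine (hpos (k + 2 - j).toNat).2.1 y ?_
      rwa [show (k + 2 - j).toNat + 1 = (k + 2 - i).toNat by omega]
    · have := R.l_neg_one_mem_hwSpace _ hy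
      rwa [show (k + 2 - i).toNat + 1 = (k + 2 - j).toNat by omega] at this
    · have := R.l_neg_two_mem_hwSpace _ hy
      rwa [show (k + 2 - i).toNat + 2 = (k + 2 - j).toNat by omega] at this
    · have := R.i_neg_one_mem_hwSpace _ hy
      rwa [show (k + 2 - i).toNat + 1 = (k + 2 - j).toNat by omega] at this
    · simp only [F, show (k + 2 - k).toNat = 2 by omega, hwSpace]
      simpa using hx0
  rw [← key j]
  infer_instance

/-! ### Commutation relations -/

theorem l_l_of_ne {n m : ℤ} (h : n + m ≠ 0) (x : V) :
    R.l n (R.l m x) = R.l m (R.l n x) + ((m : ℂ) - (n : ℂ)) • R.l (n + m) x := by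
  rw [R.l_l, if_neg h, zero_smul, add_zero]

theorem l_i_of_ne {n m : ℤ} (h : n + m ≠ 0) (x : V) :
    R.l n (R.i m x) = R.i m (R.l n x) + (m : ℂ) • R.i (n + m) x := by
  rw [R.l_i, if_neg h, zero_smul, add_zero]

theorem l_one_l_neg_one (x : V) :
    R.l 1 (R.l (-1) x) = R.l (-1) (R.l 1 x) - (2 : ℂ) • R.l 0 x := by
  rw [R.l_l]; norm_num; module

theorem i_pos_apply_eq_zero {x : V} (h₁ : R.l 1 x = 0) (h₂ : R.i 1 x = 0) {n : ℤ} (hn : 1 ≤ n) :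
    R.i n x = 0 := by
  induction n, hn using Int.leInduction with
  | base => exact h₂
  | succ n hn' ih =>
    have h := R.l_i_of_ne (n := 1) (m := n) (by omega) x
    rw [ih, h₁, map_zero, map_zero, zero_add, add_comm] at h
    exact (smul_eq_zero.mp h.symm).resolve_left (by exact_mod_cast (by omega : n ≠ 0))

theorem i_neg_apply_eq_zero {x : V} (h₁ : R.l (-1) x = 0) (h₂ : R.i (-1) x = 0) {n : ℤ}
    (hn : n ≤ -1) : R.i n x = 0 := by
  have := R.mirror.i_pos_apply_eq_zero (x := x) (by simp [mirror, h₁]) h₂ (n := -n) (by omega)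
  simpa [mirror] using this

/-! ### The Virasoro algebra -/

section Virasoro

variable {R} {m : ℤ} {v : V}

theorem l_one_l_apply (h₁ : R.l 1 v = 0) {j : ℤ} (hj : 0 ≤ j) :
    R.l 1 (R.l j v) = ((j : ℂ) - 1) • R.l (j + 1) v := by
  rw [R.l_l_of_ne (by omega), h₁, map_zero, zero_add, add_comm 1 j]; simp

/-- By induction on `j`: both sides vanish for `j = 2`, and commuting `L_1` with `L_j` on `L_{-1} v`
gives the step. -/
theorem l_l_neg_one_apply (hv : v ∈ R.W m) (h₁ : R.l 1 v = 0) (h₂ : R.l (-1) (R.l 2 v) = 0)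
    {j : ℤ} (hj : 2 ≤ j) :
    R.l j (R.l (-1) v) = (2 * (R.wt + m)) • R.l (j - 1) v := by
  have e₁ : R.l 1 (R.l (-1) v) = -(2 * (R.wt + m)) • v := by
    rw [l_one_l_neg_one, h₁, map_zero, R.l_zero m v hv]; module
  have e₂ : R.l 2 (R.l (-1) v) = 0 := by
    rw [R.l_l_of_ne (by norm_num), h₂, show (2 : ℤ) + -1 = 1 by norm_num, h₁]; simp
  induction j, hj using Int.leInduction with
  | base => rw [e₂, show (2 : ℤ) - 1 = 1 by norm_num, h₁, smul_zero]
  | succ j hj ih =>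
    have h := R.l_l_of_ne (n := 1) (m := j) (by omega) (R.l (-1) v)
    rw [ih, map_smul, l_one_l_apply h₁ (by omega), e₁, map_smul, add_comm 1 j,
      show j - 1 + 1 = j by ring] at h
    have hc : ((j : ℂ) - (1 : ℤ)) ≠ 0 := by
      rw [sub_ne_zero]; exact_mod_cast (by omega : j ≠ 1)
    refine smul_right_injective V hc ?_
    simp only [show j + 1 - 1 = j by ring]
    rw [← sub_eq_iff_eq_add'.mpr h]
    push_cast
    module

theorem l_neg_one_l_apply (hv : v ∈ R.W m) (h₁ : R.l 1 v = 0) (h₂ : R.l (-1) (R.l 2 v) = 0)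
    {j : ℤ} (hj : 2 ≤ j) :
    R.l (-1) (R.l j v) = (j + 1 + 2 * (R.wt + m)) • R.l (j - 1) v := by
  rw [R.l_l_of_ne (by omega), l_l_neg_one_apply hv h₁ h₂ hj, show -1 + j = j - 1 by ring]
  push_cast
  module

/-- Obtained by commuting `L_2` with `L_{j+1}` on `L_{-1} v` and dividing by `2 (wt + m)`. -/
theorem l_two_l_apply (hv : v ∈ R.W m) (h₁ : R.l 1 v = 0) (h₂ : R.l (-1) (R.l 2 v) = 0)
    (ha : R.wt + m ≠ 0) {j : ℤ} (hj : 2 ≤ j) :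
    R.l 2 (R.l j v) = ((j : ℂ) - 1) • R.l (j + 2) v := by
  have h := R.l_l_of_ne (n := 2) (m := j + 1) (by omega) (R.l (-1) v)
  have e₂ : R.l 2 (R.l (-1) v) = 0 := by
    rw [l_l_neg_one_apply hv h₁ h₂ le_rfl, show (2 : ℤ) - 1 = 1 by norm_num, h₁, smul_zero]
  rw [e₂, map_zero, zero_add, l_l_neg_one_apply hv h₁ h₂ (by omega),
    l_l_neg_one_apply hv h₁ h₂ (by omega), map_smul, show j + 1 - 1 = j by ring,
    show 2 + (j + 1) - 1 = j + 2 by ring] at h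
  have hc : 2 * (R.wt + m) ≠ 0 := mul_ne_zero two_ne_zero ha
  refine smul_right_injective V hc ?_
  simp only [h]
  push_cast
  module

/-- The relation `[L_{-1}, L_2] L_2 v = 3 L_3 v` reads `(2 a + 2) L_3 v = 0` with `a = wt + m`. If
`L_3 v = 0`, then `L_2 v` is a highest weight vector. -/
theorem wt_eq_neg_one (hv : v ∈ R.W m) (h₁ : R.l 1 v = 0) (h₂ : R.l (-1) (R.l 2 v) = 0)
    (ha : R.wt + m ≠ 0) (hw : R.l 2 v ≠ 0)
    (hhw : ∀ k, ∀ x ∈ R.W k, R.l 1 x = 0 → R.l 2 x = 0 → x = 0) : R.wt + m = -1 := by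
  by_contra hne
  have e₃ : R.l 1 (R.l 2 v) = R.l 3 v := by
    rw [l_one_l_apply h₁ (by norm_num)]; norm_num
  have e₄ : R.l 1 (R.l 3 v) = (2 : ℂ) • R.l 4 v := by
    rw [l_one_l_apply h₁ (by norm_num)]; norm_num
  have e₅ : R.l 2 (R.l 2 v) = R.l 4 v := by
    rw [l_two_l_apply hv h₁ h₂ ha le_rfl]; norm_num
  have h := R.l_l_of_ne (n := -1) (m := 2) (by norm_num) (R.l 2 v)
  rw [e₅, h₂, map_zero, l_neg_one_l_apply hv h₁ h₂ (by norm_num), zero_add,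
    show (-1 : ℤ) + 2 = 1 by norm_num, show (4 : ℤ) - 1 = 3 by norm_num, e₃, ← sub_eq_zero,
    ← sub_smul] at h
  have h3 : R.l 3 v = 0 := by
    refine (smul_eq_zero.mp h).resolve_left fun h0 => hne ?_
    push_cast at h0
    linear_combination h0 / 2
  rw [h3] at e₃ e₄
  rw [map_zero] at e₄
  have h4 : R.l 4 v = 0 := (smul_eq_zero.mp e₄.symm).resolve_left two_ne_zero
  exact hw (hhw _ _ (R.l_mem 2 m _ rfl v hv) e₃ (e₅.trans h4))

theorem l_neg_two_l_apply (hv : v ∈ R.W m) (h₁ : R.l 1 v = 0) (h₂ : R.l (-1) (R.l 2 v) = 0)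
    (h₃ : R.l (-2) (R.l 3 v) = 0) (ha : R.wt + m = -1) {j : ℤ} (hj : 3 ≤ j) :
    R.l (-2) (R.l j v) = ((j : ℂ) - 1) • R.l (j - 2) v := by
  induction j, hj using Int.leInduction with
  | base => rw [h₃, show (3 : ℤ) - 2 = 1 by norm_num, h₁, smul_zero]
  | succ j hj ih =>
    have h := R.l_l_of_ne (n := -2) (m := 1) (by norm_num) (R.l j v)
    rw [ih, l_one_l_apply h₁ (by omega), map_smul, map_smul, l_one_l_apply h₁ (by omega),
      show (-2 : ℤ) + 1 = -1 by norm_num, l_neg_one_l_apply hv h₁ h₂ (by omega), ha] at h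
    have hc : (j : ℂ) - 1 ≠ 0 := by
      rw [sub_ne_zero]; exact_mod_cast (by omega : j ≠ 1)
    refine smul_right_injective V hc ?_
    simp only [h, show j - 2 + 1 = j - 1 by ring, show j + 1 - 2 = j - 1 by ring]
    push_cast
    module

/-- If the `I_n` act by zero, a vector `v` with these properties generates a module whose weight
spaces have dimension at most one, unless there is a highest or lowest weight vector. -/
theorem finiteDimensional_of_i_eq_zero (hi : ∀ n k, ∀ x ∈ R.W k, R.i n x = 0)
    (hv : v ∈ R.W m) (hv0 : v ≠ 0) (h₁ : R.l 1 v = 0) (h₂ : R.l (-1) (R.l 2 v) = 0)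
    (h₃ : R.l (-2) (R.l 3 v) = 0) (k : ℤ) : FiniteDimensional ℂ (R.W k) := by
  by_contra hk
  have hhw : ∀ k, ∀ x ∈ R.W k, R.l 1 x = 0 → R.l 2 x = 0 → x = 0 := fun j x hx e₁ e₂ => by
    by_contra hx0
    exact hk (R.finiteDimensional_of_highest hx hx0 e₁ e₂ (hi _ _ x hx) k)
  have hlw : ∀ k, ∀ x ∈ R.mirror.W k, R.mirror.l 1 x = 0 → R.mirror.l 2 x = 0 → x = 0 :=
    fun j x hx e₁ e₂ => by
      by_contra hx0
      have := R.mirror.finiteDimensional_of_highest hx hx0 e₁ e₂ (hi _ _ x hx) (-k)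
      exact hk (R.mirror_W_neg k ▸ this)
  obtain ⟨w, hw⟩ : ∃ w, w = R.l 2 v := ⟨_, rfl⟩
  obtain ⟨u, hu⟩ : ∃ u, u = R.l (-2) w := ⟨_, rfl⟩
  have hwW : w ∈ R.W (m + 2) := hw ▸ R.l_mem 2 m _ rfl v hv
  have hwW' : w ∈ R.mirror.W (-m - 2) := by
    change w ∈ R.W (-(-m - 2)); rwa [show -(-m - 2) = m + 2 by ring]
  have huW : u ∈ R.W m := hu ▸ R.l_mem (-2) _ _ (by ring) w hwW
  rw [← hw] at h₂
  have hw0 : w ≠ 0 := fun h => hv0 (hhw m v hv h₁ (hw ▸ h))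
  have h₂' : R.mirror.l 1 w = 0 := by simp [mirror, h₂]
  have hu' : R.mirror.l 2 w = -u := by simp [mirror, hu]
  have hu0 : R.mirror.l 2 w ≠ 0 := fun h => hw0 (hlw _ w hwW' h₂' h)
  have h13 : R.l 1 w = R.l 3 v := by
    rw [hw, l_one_l_apply h₁ (by norm_num)]; norm_num
  have h1u : R.l 1 u = 0 := by
    rw [hu, R.l_l_of_ne (by norm_num), h13, h₃, show (1 : ℤ) + -2 = -1 by norm_num, h₂]; simp
  have h1u' : R.mirror.l (-1) (R.mirror.l 2 w) = 0 := by
    rw [hu']; simp [mirror, h1u]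
  -- The conditions `a ∈ {0, -1}` from `v` and `-(a + 2) ∈ {0, -1}` from `w` in the mirror module
  -- leave only `a = -1`.
  have ha : R.wt + m = -1 := by
    have c₁ : R.wt + m = 0 ∨ R.wt + m = -1 :=
      or_iff_not_imp_left.mpr fun h => wt_eq_neg_one hv h₁ (hw ▸ h₂) h (hw ▸ hw0) hhw
    have c₂ : R.mirror.wt + (-m - 2 : ℤ) = 0 ∨ R.mirror.wt + (-m - 2 : ℤ) = -1 :=
      or_iff_not_imp_left.mpr fun h => wt_eq_neg_one hwW' h₂' h1u' h hu0 hlw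
    have e : R.mirror.wt + (-m - 2 : ℤ) = -(R.wt + m) - 2 := by
      simp only [mirror]; push_cast; ring
    rw [e] at c₂
    rcases c₁ with c₁ | c₁
    · rw [c₁] at c₂; norm_num at c₂
    · exact c₁
  have ha' : R.mirror.wt + (-m - 2 : ℤ) = -1 := by
    simp only [mirror]; push_cast; linear_combination -ha
  have ha0 : R.wt + m ≠ 0 := by rw [ha]; norm_num
  have ha0' : R.mirror.wt + (-m - 2 : ℤ) ≠ 0 := by rw [ha']; norm_num
  -- Evaluate `[L_{-2}, L_2]` on `w`, using `L_2 w = L_4 v` and `L_{-2} L_4 v = 3 w`.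
  have h2u : ∃ s : ℂ, R.l 2 u = s • w := by
    have e := R.l_l (-2) 2 w
    have e' : R.l 2 w = R.l 4 v := by
      rw [hw, l_two_l_apply hv h₁ (hw ▸ h₂) ha0 le_rfl]; norm_num
    rw [e', l_neg_two_l_apply hv h₁ (hw ▸ h₂) h₃ ha (by norm_num), ← hu,
      show (4 : ℤ) - 2 = 2 by norm_num, ← hw, show (-2 : ℤ) + 2 = 0 by norm_num,
      R.l_zero _ w hwW, add_assoc, ← sub_eq_iff_eq_add, smul_smul, ← add_smul, ← sub_smul] at e
    exact ⟨_, e.symm⟩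
  have h₃' : R.mirror.l (-2) (R.mirror.l 3 w) = 0 := by
    obtain ⟨s, hs⟩ := h2u
    have e : R.l (-1) u = -R.l (-3) w := by
      rw [hu, R.l_l_of_ne (by norm_num), h₂, show (-1 : ℤ) + -2 = -3 by norm_num]
      push_cast; simp only [map_zero]; module
    have e' : R.l 2 (R.l (-1) u) = 0 := by
      rw [R.l_l_of_ne (by norm_num), hs, map_smul, h₂, show (2 : ℤ) + -1 = 1 by norm_num, h1u]
      simp
    rw [e, map_neg, neg_eq_zero] at e'
    simpa [mirror] using e'
  -- The vector `E r` spans the component of degree `m + 1 + r` of the submodule; in degree `m + 1`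
  -- this submodule is zero.
  let E : ℤ → V := fun r => if 1 ≤ r then R.l (r + 1) v else if r ≤ -1 then R.l (r - 1) w else 0
  have E_pos : ∀ r, 1 ≤ r → E r = R.l (r + 1) v := fun r hr => if_pos hr
  have E_neg : ∀ r, r ≤ -1 → E r = -R.mirror.l (-r + 1) w := fun r hr => by
    simp only [E, mirror, if_neg (by omega : ¬ 1 ≤ r), if_pos hr, LinearMap.neg_apply, neg_neg]
    rw [show -(-r + 1) = r - 1 by ring]
  have E_zero : E 0 = 0 := by simp [E]
  have hEW : ∀ k, E (k - m - 1) ∈ R.W k := fun k => by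
    simp only [E]
    split_ifs
    · exact R.l_mem _ m _ (by ring) v hv
    · exact R.l_mem _ (m + 2) _ (by ring) w hwW
    · exact zero_mem _
  have s₁ : ∀ r, ∃ s : ℂ, R.l 1 (E r) = s • E (r + 1) := fun r => by
    rcases lt_trichotomy r 0 with hr | rfl | hr
    · have h := l_neg_one_l_apply hwW' h₂' h1u' (j := -r + 1) (by omega)
      rw [E_neg r (by omega), map_neg]
      by_cases hr' : r = -1
      · subst hr'
        rw [show -(-1 : ℤ) + 1 = 2 by norm_num, hu']
        exact ⟨0, by simp [h1u]⟩
      · rw [E_neg (r + 1) (by omega), show -(r + 1) + 1 = -r + 1 - 1 by ring]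
        exact ⟨-_, by rw [smul_neg, neg_smul, neg_neg, ← h]; simp [mirror]⟩
    · exact ⟨0, by simp [E_zero]⟩
    · rw [E_pos r (by omega), E_pos (r + 1) (by omega)]
      exact ⟨_, l_one_l_apply h₁ (by omega)⟩
  have s₂ : ∀ r, ∃ s : ℂ, R.l 2 (E r) = s • E (r + 2) := fun r => by
    rcases lt_trichotomy r 0 with hr | rfl | hr
    · by_cases hr' : r = -1
      · subst hr'
        rw [E_neg (-1) le_rfl, E_pos _ (by norm_num), show -(-1 : ℤ) + 1 = 2 by norm_num, hu',
          neg_neg, show (-1 : ℤ) + 2 + 1 = 2 by norm_num, ← hw]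
        exact h2u
      have h := l_neg_two_l_apply hwW' h₂' h1u' h₃' ha' (j := -r + 1) (by omega)
      rw [E_neg r (by omega), map_neg]
      by_cases hr2 : r = -2
      · subst hr2
        rw [show -(-2 : ℤ) + 1 - 2 = 1 by norm_num, h₂', smul_zero] at h
        exact ⟨0, by simpa [mirror] using h⟩
      · rw [E_neg (r + 2) (by omega), show -(r + 2) + 1 = -r + 1 - 2 by ring]
        exact ⟨-_, by rw [smul_neg, neg_smul, neg_neg, ← h]; simp [mirror]⟩
    · exact ⟨0, by simp [E_zero]⟩
    · rw [E_pos r (by omega), E_pos (r + 2) (by omega), show r + 2 + 1 = r + 1 + 2 by ring]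
      exact ⟨_, l_two_l_apply hv h₁ (hw ▸ h₂) ha0 (by omega)⟩
  have s₃ : ∀ r, ∃ s : ℂ, R.l (-1) (E r) = s • E (r + -1) := fun r => by
    rcases lt_trichotomy r 0 with hr | rfl | hr
    · have h := l_one_l_apply h₂' (j := -r + 1) (by omega)
      rw [E_neg r (by omega), map_neg, E_neg (r + -1) (by omega),
        show -(r + -1) + 1 = -r + 1 + 1 by ring]
      exact ⟨-_, by rw [smul_neg, neg_smul, neg_neg, ← h]; simp [mirror]⟩
    · exact ⟨0, by simp [E_zero]⟩
    · have h := l_neg_one_l_apply hv h₁ (hw ▸ h₂) (j := r + 1) (by omega)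
      rw [E_pos r (by omega)]
      by_cases hr' : r = 1
      · subst hr'
        exact ⟨0, by rw [h]; simp [h₁]⟩
      · rw [E_pos (r + -1) (by omega), show r + -1 + 1 = r + 1 - 1 by ring]
        exact ⟨_, h⟩
  have s₄ : ∀ r, ∃ s : ℂ, R.l (-2) (E r) = s • E (r + -2) := fun r => by
    rcases lt_trichotomy r 0 with hr | rfl | hr
    · have h := l_two_l_apply hwW' h₂' h1u' ha0' (j := -r + 1) (by omega)
      rw [E_neg r (by omega), map_neg, E_neg (r + -2) (by omega),
        show -(r + -2) + 1 = -r + 1 + 2 by ring]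
      exact ⟨-_, by rw [smul_neg, neg_smul, neg_neg, ← h]; simp [mirror]⟩
    · exact ⟨0, by simp [E_zero]⟩
    · rw [E_pos r (by omega)]
      by_cases hr' : r = 1
      · subst hr'
        rw [E_neg (1 + -2) (by omega), show -(1 + -2 : ℤ) + 1 = 2 by norm_num, hu',
          show (1 : ℤ) + 1 = 2 by norm_num, ← hw, ← hu]
        exact ⟨1, by simp⟩
      have h := l_neg_two_l_apply hv h₁ (hw ▸ h₂) h₃ ha (j := r + 1) (by omega)
      by_cases hr2 : r = 2
      · subst hr2
        rw [h, show (2 : ℤ) + 1 - 2 = 1 by norm_num, h₁]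
        exact ⟨0, by simp⟩
      · rw [E_pos (r + -2) (by omega), show r + -2 + 1 = r + 1 - 2 by ring]
        exact ⟨_, h⟩
  have hle : ∀ k, (ℂ ∙ E (k - m - 1)) ≤ R.W k := fun k => by simpa using hEW k
  have stab : ∀ (n : ℤ), (∀ r, ∃ s : ℂ, R.l n (E r) = s • E (r + n)) → ∀ j k, j + n = k →
      ∀ x ∈ ℂ ∙ E (j - m - 1), R.l n x ∈ ℂ ∙ E (k - m - 1) := by
    rintro n hn j k rfl x hx
    obtain ⟨t, rfl⟩ := Submodule.mem_span_singleton.mp hx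
    obtain ⟨s, hs⟩ := hn (j - m - 1)
    rw [map_smul, hs, show j - m - 1 + n = j + n - m - 1 by ring]
    exact Submodule.smul_mem _ _ (Submodule.smul_mem _ _ (Submodule.mem_span_singleton_self _))
  have key := R.eq_W_of_gen (F := fun k => ℂ ∙ E (k - m - 1)) hle (stab 1 s₁) (stab 2 s₂)
    (fun j k _ x hx => by rw [hi _ _ x (hle j hx)]; exact zero_mem _) (stab (-1) s₃)
    (stab (-2) s₄) (fun j k _ x hx => by rw [hi _ _ x (hle j hx)]; exact zero_mem _)
    ⟨m + 2, by
      rw [show m + 2 - m - 1 = 1 by ring, E_pos 1 le_rfl, show (1 : ℤ) + 1 = 2 by norm_num, ← hw]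
      simpa using hw0⟩ k
  refine hk ?_
  rw [← key]
  infer_instance

end Virasoro

/-! ### Vanishing of the Heisenberg part -/

/-- If `v` is killed by suitable operators of degree one, and there are no highest or lowest weight
vectors, then the `I_n` with `n ≠ 0` act by zero. -/
theorem i_apply_eq_zero {m : ℤ} {v : V} (hv : v ∈ R.W m)
    (hhw : ∀ k, ∀ x ∈ R.W k, R.l 1 x = 0 → R.l 2 x = 0 → R.i 1 x = 0 → x = 0)
    (hlw : ∀ k, ∀ x ∈ R.W k, R.l (-1) x = 0 → R.l (-2) x = 0 → R.i (-1) x = 0 → x = 0)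
    (hv0 : v ≠ 0) (h₁ : R.l 1 v = 0) (h₁' : R.i 1 v = 0) (h₂ : R.l (-1) (R.l 2 v) = 0)
    (h₂' : R.i (-1) (R.l 2 v) = 0) (h₃ : R.l (-2) (R.l 3 v) = 0)
    (h₄ : R.l (-1) (R.l 2 (R.l (-2) (R.l 2 v))) = 0)
    (h₄' : R.i (-1) (R.l 2 (R.l (-2) (R.l 2 v))) = 0) (n k : ℤ) :
    ∀ x ∈ R.W k, R.i n x = 0 := by
  have h13 : R.l 1 (R.l 2 v) = R.l 3 v := by
    rw [l_one_l_apply h₁ (by norm_num)]; norm_num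
  have hwi : ∀ n, 1 ≤ n → R.i n (R.l 2 v) = 0 := fun n hn => by
    have h := R.l_i_of_ne (n := 2) (m := n) (by omega) v
    rwa [R.i_pos_apply_eq_zero h₁ h₁' hn, R.i_pos_apply_eq_zero h₁ h₁' (by omega), map_zero,
      smul_zero, add_zero, eq_comm] at h
  have hwW : R.l 2 v ∈ R.W (m + 2) := R.l_mem 2 m _ rfl v hv
  obtain ⟨w, hw⟩ : ∃ w, w = R.l 2 v := ⟨_, rfl⟩
  have hw0 : w ≠ 0 := fun h => hv0 (hhw m v hv h₁ (hw ▸ h) h₁')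
  rw [← hw] at h₂ h₂' h₄ h₄' h13 hwi hwW
  obtain ⟨u, hu⟩ : ∃ u, u = R.l (-2) w := ⟨_, rfl⟩
  have hu0 : u ≠ 0 := fun h => hw0 (hlw _ w hwW h₂ (hu ▸ h) h₂')
  rw [← hu] at h₄ h₄'
  have h1u : R.l 1 u = 0 := by
    rw [hu, R.l_l_of_ne (by norm_num), h13, h₃, show (1 : ℤ) + -2 = -1 by norm_num, h₂]; simp
  have hiu : ∀ n, n ≤ -1 → R.i n u = 0 := fun n hn => by
    have h := R.l_i_of_ne (n := -2) (m := n) (by omega) w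
    rwa [R.i_neg_apply_eq_zero h₂ h₂' hn, R.i_neg_apply_eq_zero h₂ h₂' (by omega), map_zero,
      smul_zero, add_zero, eq_comm, ← hu] at h
  -- Since `I_{-1}, I_{-2}` kill `u` and `I_{-2}` kills `L_2 u`, the cocycle vanishes at `1` and `2`.
  have e₁ := R.l_i 1 (-1) u
  rw [hiu (-1) le_rfl, map_zero, h1u, map_zero, show (1 : ℤ) + -1 = 0 by norm_num, R.i_zero,
    smul_zero, zero_add, zero_add, if_pos rfl, eq_comm] at e₁
  have e₂ := R.l_i 2 (-2) u
  rw [hiu (-2) (by norm_num), map_zero, R.i_neg_apply_eq_zero h₄ h₄' (by norm_num),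
    show (2 : ℤ) + -2 = 0 by norm_num, R.i_zero,
    smul_zero, zero_add, zero_add, if_pos rfl, eq_comm] at e₂
  replace e₁ := (smul_eq_zero.mp e₁).resolve_right hu0
  replace e₂ := (smul_eq_zero.mp e₂).resolve_right hu0
  push_cast at e₁ e₂
  have hq : R.q = 0 := by linear_combination e₂ / 2 - e₁
  have hp : R.p = 0 := by linear_combination e₁ - hq
  let K : Submodule ℂ V := ⨅ n, LinearMap.ker (R.i n)
  have hK : ∀ x, x ∈ K ↔ ∀ n, R.i n x = 0 := fun x => by simp [K, Submodule.mem_iInf]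
  have key := R.irr (fun k => R.W k ⊓ K) (fun k => inf_le_left)
    (fun n j k hjk x hx => ⟨R.l_mem n j k hjk x hx.1, (hK _).mpr fun r => by
      have h := R.l_i n r x
      have hx' := (hK x).mp hx.2
      rw [hx', hx', hp, hq] at h
      simpa using h.symm⟩)
    (fun n j k hjk x hx => by rw [(hK x).mp hx.2]; exact zero_mem _)
    ⟨m + 2, fun h => hw0 ((Submodule.eq_bot_iff _).mp h w ⟨hwW, (hK w).mpr fun n => by
      rcases lt_trichotomy n 0 with hn | rfl | hn
      · exact R.i_neg_apply_eq_zero h₂ h₂' (by omega)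
      · exact R.i_zero w
      · exact hwi n hn⟩)⟩ k
  intro x hx
  rw [← key] at hx
  exact (hK x).mp hx.2 n

/-! ### Comparison of weight spaces -/

/-- The heart of the argument: an infinite-dimensional `W m` would contain a nonzero vector that is
killed by the seven operators into the finite-dimensional space `W (m + 1)` which are used below. -/
theorem finiteDimensional_of_succ {m : ℤ} (hfin : FiniteDimensional ℂ (R.W (m + 1))) :
    FiniteDimensional ℂ (R.W m) := by
  by_contra hinf
  have hhw : ∀ k, ∀ x ∈ R.W k, R.l 1 x = 0 → R.l 2 x = 0 → R.i 1 x = 0 → x = 0 :=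
    fun j x hx e₁ e₂ e₃ => by
      by_contra hx0
      exact hinf (R.finiteDimensional_of_highest hx hx0 e₁ e₂ e₃ m)
  have hlw : ∀ k, ∀ x ∈ R.W k, R.l (-1) x = 0 → R.l (-2) x = 0 → R.i (-1) x = 0 → x = 0 :=
    fun j x hx e₁ e₂ e₃ => by
      by_contra hx0
      have := R.mirror.finiteDimensional_of_highest (x := x) (k := -j) (by simpa [mirror] using hx)
        hx0 (by simp [mirror, e₁]) (by simp [mirror, e₂]) e₃ (-m)
      exact hinf (R.mirror_W_neg m ▸ this)
  have cut : ∀ K : Submodule ℂ V, K ≤ R.W m → ¬ FiniteDimensional ℂ K → ∀ f : Module.End ℂ V,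
      (∀ x ∈ R.W m, f x ∈ R.W (m + 1)) →
      (K ⊓ LinearMap.ker f ≤ R.W m ∧
        ¬ FiniteDimensional ℂ (K ⊓ LinearMap.ker f : Submodule ℂ V)) :=
    fun K hK hKinf f hf => ⟨inf_le_left.trans hK,
      not_finiteDimensional_inf_ker hKinf hfin f fun x hx => hf x (hK hx)⟩
  have ne_bot : ∀ K : Submodule ℂ V, ¬ FiniteDimensional ℂ K → K ≠ ⊥ := by
    rintro _ hK rfl
    exact hK inferInstance
  have m₂ : ∀ x ∈ R.W m, R.l 2 x ∈ R.W (m + 2) := R.l_mem 2 _ _ rfl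
  have m₃ : ∀ x ∈ R.W m, R.l 3 x ∈ R.W (m + 3) := R.l_mem 3 _ _ rfl
  have m₄ : ∀ x ∈ R.W m, R.l 2 (R.l (-2) (R.l 2 x)) ∈ R.W (m + 2) := fun x hx =>
    R.l_mem 2 m _ rfl _ (R.l_mem (-2) _ _ (by ring) _ (m₂ x hx))
  obtain ⟨l₁, c₁⟩ := cut _ le_rfl hinf (R.l 1) (R.l_mem 1 _ _ rfl)
  obtain ⟨l₂, c₂⟩ := cut _ l₁ c₁ (R.i 1) (R.i_mem 1 _ _ rfl)
  obtain ⟨l₃, c₃⟩ := cut _ l₂ c₂ (R.l (-1) ∘ₗ R.l 2)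
    (fun x hx => R.l_mem (-1) _ _ (by ring) _ (m₂ x hx))
  obtain ⟨l₄, c₄⟩ := cut _ l₃ c₃ (R.i (-1) ∘ₗ R.l 2)
    (fun x hx => R.i_mem (-1) _ _ (by ring) _ (m₂ x hx))
  obtain ⟨l₅, c₅⟩ := cut _ l₄ c₄ (R.l (-2) ∘ₗ R.l 3)
    (fun x hx => R.l_mem (-2) _ _ (by ring) _ (m₃ x hx))
  obtain ⟨l₆, c₆⟩ := cut _ l₅ c₅ (R.l (-1) ∘ₗ R.l 2 ∘ₗ R.l (-2) ∘ₗ R.l 2)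
    (fun x hx => R.l_mem (-1) _ _ (by ring) _ (m₄ x hx))
  obtain ⟨l₇, c₇⟩ := cut _ l₆ c₆ (R.i (-1) ∘ₗ R.l 2 ∘ₗ R.l (-2) ∘ₗ R.l 2)
    (fun x hx => R.i_mem (-1) _ _ (by ring) _ (m₄ x hx))
  obtain ⟨v, ⟨⟨⟨⟨⟨⟨⟨hv, h₁⟩, h₁'⟩, h₂⟩, h₂'⟩, h₃⟩, h₄⟩, h₄'⟩, hv0⟩ :=
    Submodule.exists_mem_ne_zero_of_ne_bot (ne_bot _ c₇)
  exact hinf (finiteDimensional_of_i_eq_zero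
    (R.i_apply_eq_zero hv hhw hlw hv0 h₁ h₁' h₂ h₂' h₃ h₄ h₄') hv hv0 h₁ h₂ h₃ m)

theorem finiteDimensional_of_finiteDimensional {j : ℤ} (h : FiniteDimensional ℂ (R.W j)) (k : ℤ) :
    FiniteDimensional ℂ (R.W k) := by
  have down : ∀ (R : GradedHVModule V) (j k : ℤ), FiniteDimensional ℂ (R.W j) → k ≤ j →
      FiniteDimensional ℂ (R.W k) := fun R j k h hkj => by
    induction k, hkj using Int.leInductionDown with
    | base => exact h
    | pred k _ ih => exact R.finiteDimensional_of_succ (by rwa [sub_add_cancel])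
  rcases le_total k j with hkj | hkj
  · exact down R j k h hkj
  · have := down R.mirror (-j) (-k) ((R.mirror_W_neg j).symm ▸ h) (by omega)
    exact R.mirror_W_neg k ▸ this

end GradedHVModule

/-! ### Irreducible weight modules as graded modules -/

namespace TwistedHV

section Modules

variable {M : Type*} [AddCommGroup M] [Module ℂ M] [LieRingModule TwistedHV M]
  [LieModule ℂ TwistedHV M]

theorem eq_top_of_gen_mem [LieModule.IsIrreducible ℂ TwistedHV M] (N : Submodule ℂ M)
    (hN : ∀ g, ∀ x ∈ N, ⁅gen g, x⁆ ∈ N) (hne : N ≠ ⊥) : N = ⊤ := by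
  let N' : LieSubmodule ℂ TwistedHV M :=
    { N with
      lie_mem := fun {a x} hx => by
        induction a using induction_gen with
        | zero => rw [zero_lie]; exact N.zero_mem
        | add a b ha hb => rw [add_lie]; exact N.add_mem ha hb
        | smul c a ha => rw [smul_lie]; exact N.smul_mem c ha
        | gen g => exact hN g x hx }
  have h : N' = ⊥ ∨ N' = ⊤ := eq_bot_or_eq_top N'
  rcases h with h | h
  · exact absurd (congrArg LieSubmodule.toSubmodule h) hne
  · exact congrArg LieSubmodule.toSubmodule h

/-- A central element of the Cartan subalgebra acts by a scalar on an irreducible weight module. -/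
theorem exists_smul_of_central [LieModule.IsIrreducible ℂ TwistedHV M] (hwt : IsWeightModule M)
    {z : TwistedHV} (hz : z ∈ cartan) (hc : ∀ g, ⁅gen g, z⁆ = 0) :
    ∃ s : ℂ, ∀ x : M, ⁅z, x⁆ = s • x := by
  have : ∃ χ : cartan →ₗ[ℂ] ℂ, cartanEigenspace M χ ≠ ⊥ := by
    by_contra! h
    have : Nontrivial (LieSubmodule ℂ TwistedHV M) := IsSimpleOrder.toNontrivial
    rw [IsWeightModule, iSup_eq_bot.mpr h] at hwt
    refine bot_ne_top (α := LieSubmodule ℂ TwistedHV M) ?_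
    exact LieSubmodule.toSubmodule_injective hwt
  obtain ⟨χ, hχ⟩ := this
  refine ⟨χ ⟨z, hz⟩, fun x => ?_⟩
  have hle : cartanEigenspace M χ ≤
      Module.End.eigenspace (LieModule.toEnd ℂ TwistedHV M z) (χ ⟨z, hz⟩) :=
    iInf_le (fun h : cartan =>
      Module.End.eigenspace (LieModule.toEnd ℂ TwistedHV M (h : TwistedHV)) (χ h)) ⟨z, hz⟩
  have htop := eq_top_of_gen_mem
    (Module.End.eigenspace (LieModule.toEnd ℂ TwistedHV M z) (χ ⟨z, hz⟩))
    (fun g y hy => by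
      rw [Module.End.mem_eigenspace_iff, LieModule.toEnd_apply_apply] at hy ⊢
      have h := lie_lie (gen g) z y
      rw [hc, zero_lie, hy, lie_smul, eq_comm, sub_eq_zero] at h
      exact h.symm)
    (fun h => hχ (le_bot_iff.mp (h ▸ hle)))
  have hx : x ∈ (⊤ : Submodule ℂ M) := Submodule.mem_top
  rw [← htop, Module.End.mem_eigenspace_iff] at hx
  exact hx

theorem mem_weightSpace {s : ℂ} {x : M} : x ∈ weightSpace M s ↔ ⁅L 0, x⁆ = s • x :=
  Module.End.mem_eigenspace_iff

theorem lie_L_L (n m : ℤ) : ⁅L n, L m⁆ = ((m : ℂ) - (n : ℂ)) • L (n + m) +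
    (if n + m = 0 then (((n : ℂ) ^ 3 - n) / 12) else 0) • C := lie_gen_gen _ _

theorem lie_L_I (n m : ℤ) : ⁅L n, I m⁆ = (m : ℂ) • I (n + m) +
    (if n + m = 0 then ((n : ℂ) ^ 2 + n) else 0) • CLI := lie_gen_gen _ _

theorem lie_I_I (n m : ℤ) : ⁅I n, I m⁆ = (if n + m = 0 then (n : ℂ) else 0) • CI :=
  lie_gen_gen _ _

theorem lie_gen_I_zero (g : THVIndex) : ⁅gen g, I 0⁆ = 0 := by
  rw [I, lie_gen_gen]
  cases g <;> simp only [genBracket]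
  case L n => by_cases h : n = 0 <;> simp [h]
  case I n => by_cases h : n = 0 <;> simp [h]

theorem lie_gen_C (g : THVIndex) : ⁅gen g, C⁆ = 0 := by
  rw [C, lie_gen_gen]; cases g <;> rfl

theorem lie_gen_CI (g : THVIndex) : ⁅gen g, CI⁆ = 0 := by
  rw [CI, lie_gen_gen]; cases g <;> rfl

theorem lie_gen_CLI (g : THVIndex) : ⁅gen g, CLI⁆ = 0 := by
  rw [CLI, lie_gen_gen]; cases g <;> rfl

theorem L_lie_mem_weightSpace {s t : ℂ} {n : ℤ} (h : s + n = t) {x : M}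
    (hx : x ∈ weightSpace M s) : ⁅L n, x⁆ ∈ weightSpace M t := by
  rw [mem_weightSpace] at hx ⊢
  rw [leibniz_lie, hx, lie_L_L, ← h]
  simp [add_smul, add_comm]

theorem I_lie_mem_weightSpace {s t : ℂ} {n : ℤ} (h : s + n = t) {x : M}
    (hx : x ∈ weightSpace M s) : ⁅I n, x⁆ ∈ weightSpace M t := by
  rw [mem_weightSpace] at hx ⊢
  rw [leibniz_lie, hx, lie_L_I, ← h]
  simp [add_smul, add_comm]

theorem iSupIndep_weightSpace : iSupIndep (weightSpace M) :=
  Module.End.eigenspaces_iSupIndep (LieModule.toEnd ℂ TwistedHV M (L 0))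

theorem iSupIndep_weightSpace_add_int (lam : ℂ) :
    iSupIndep fun k : ℤ => weightSpace M (lam + k) :=
  (iSupIndep_weightSpace (M := M)).comp (f := fun k : ℤ => lam + (k : ℂ))
    fun a b h => by simpa using h

theorem iSup_eq_top_of_gradedStable [LieModule.IsIrreducible ℂ TwistedHV M] {c₀ c₁ c₂ : ℂ}
    (hC : ∀ x : M, ⁅C, x⁆ = c₀ • x) (hCI : ∀ x : M, ⁅CI, x⁆ = c₁ • x)
    (hCLI : ∀ x : M, ⁅CLI, x⁆ = c₂ • x) {F : ℤ → Submodule ℂ M}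
    (hL : ∀ n k, ∀ x ∈ F k, ⁅L n, x⁆ ∈ F (k + n))
    (hI : ∀ n k, ∀ x ∈ F k, ⁅I n, x⁆ ∈ F (k + n)) (hne : ∃ k, F k ≠ ⊥) : ⨆ k, F k = ⊤ := by
  refine eq_top_of_gen_mem _ (fun g x hx => ?_) fun h => ?_
  · induction hx using Submodule.iSup_induction' with
    | zero => rw [lie_zero]; exact zero_mem _
    | add x y _ _ hx hy => rw [lie_add]; exact add_mem hx hy
    | mem k x hx =>
      cases g with
      | L n => exact Submodule.mem_iSup_of_mem _ (hL n k x hx)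
      | I n => exact Submodule.mem_iSup_of_mem _ (hI n k x hx)
      | C => rw [← C, hC]; exact Submodule.smul_mem _ _ (Submodule.mem_iSup_of_mem k hx)
      | CI => rw [← CI, hCI]; exact Submodule.smul_mem _ _ (Submodule.mem_iSup_of_mem k hx)
      | CLI => rw [← CLI, hCLI]; exact Submodule.smul_mem _ _ (Submodule.mem_iSup_of_mem k hx)
  · obtain ⟨k, hk⟩ := hne
    exact hk (iSup_eq_bot.mp h k)

/-- An irreducible weight module as a graded module, with the eigenspace of `L_0` for `lam + k` in
degree `k`. The linear coefficient of the cocycle combines the term `n C_{LI}` of `[L_n, I_{-n}]`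
with its term `-n I_0`. -/
noncomputable def toGradedHVModule [LieModule.IsIrreducible ℂ TwistedHV M] (lam : ℂ)
    {h₀ c₀ c₁ c₂ : ℂ} (hI₀ : ∀ x : M, ⁅I 0, x⁆ = h₀ • x) (hC : ∀ x : M, ⁅C, x⁆ = c₀ • x)
    (hCI : ∀ x : M, ⁅CI, x⁆ = c₁ • x) (hCLI : ∀ x : M, ⁅CLI, x⁆ = c₂ • x) :
    GradedHVModule M where
  l n := LieModule.toEnd ℂ TwistedHV M (L n)
  i n := if n = 0 then 0 else LieModule.toEnd ℂ TwistedHV M (I n)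
  W k := weightSpace M (lam + k)
  wt := lam
  c := c₀
  d := c₁
  p := c₂ - h₀
  q := c₂
  i_zero x := by simp
  l_zero k x hx := mem_weightSpace.mp hx
  l_mem n j k h x hx := L_lie_mem_weightSpace (by rw [← h]; push_cast; ring) hx
  i_mem n j k h x hx := by
    split_ifs
    · exact zero_mem _
    · exact I_lie_mem_weightSpace (by rw [← h]; push_cast; ring) hx
  l_l n m x := by
    simp only [LieModule.toEnd_apply_apply]
    rw [leibniz_lie, lie_L_L, add_lie, smul_lie, smul_lie, hC, smul_smul, ite_mul, zero_mul]
    abel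
  l_i n m x := by
    by_cases hm : m = 0
    · subst hm
      by_cases hn : n = 0 <;> simp [hn]
    · rw [if_neg hm]
      simp only [LieModule.toEnd_apply_apply]
      rw [leibniz_lie, lie_L_I, add_lie, smul_lie, smul_lie, hCLI, smul_smul]
      by_cases h : n + m = 0
      · obtain rfl : m = -n := by omega
        simp only [h, if_true, hI₀, LinearMap.zero_apply]
        push_cast
        module
      · simp only [h, if_false, LieModule.toEnd_apply_apply]
        module
  i_i n m x := by
    by_cases hm : m = 0
    · subst hm
      by_cases hn : n = 0 <;> simp [hn]
    · by_cases hn : n = 0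
      · subst hn
        simp [hm]
      · rw [if_neg hm, if_neg hn]
        simp only [LieModule.toEnd_apply_apply]
        rw [leibniz_lie, lie_I_I, smul_lie, hCI, smul_smul, ite_mul, zero_mul, add_comm]
  irr F hF hl hi hne k := by
    have htop := iSup_eq_top_of_gradedStable hC hCI hCLI (F := F)
      (fun n k x hx => hl n k _ rfl x hx)
      (fun n k x hx => by
        by_cases hn : n = 0
        · subst hn
          rw [hI₀, add_zero]
          exact Submodule.smul_mem _ _ hx
        · simpa [hn] using hi n k _ rfl x hx) hne
    -- As the sum of the `F j` is everything and `F j ≤ W j` with the `W j` independent, modularity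
    -- gives `W k ≤ F k`.
    have hsplit : F k ⊔ ⨆ j ≠ k, F j = ⊤ := by
      rw [← htop]
      exact (iSup_split_single F k).symm
    have hdisj := (iSupIndep_weightSpace_add_int (M := M) lam k).mono_right
      (iSup₂_mono fun j _ => hF j : ⨆ j ≠ k, F j ≤ ⨆ j ≠ k, weightSpace M (lam + j))
    refine le_antisymm (hF k) ?_
    calc weightSpace M (lam + k) = (F k ⊔ ⨆ j ≠ k, F j) ⊓ weightSpace M (lam + k) := by
          rw [hsplit, top_inf_eq]
      _ = F k ⊔ (⨆ j ≠ k, F j) ⊓ weightSpace M (lam + k) := sup_inf_assoc_of_le _ (hF k)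
      _ = F k := by rw [hdisj.symm.eq_bot, sup_bot_eq]
      _ ≤ F k := le_rfl

end Modules

end TwistedHV

theorem theorem1p3 (M : Type*) [AddCommGroup M] [Module ℂ M]
    [LieRingModule TwistedHV M] [LieModule ℂ TwistedHV M]
    (hirr : LieModule.IsIrreducible ℂ TwistedHV M)
    (hwt : TwistedHV.IsWeightModule M)
    (lam : ℂ)
    (hinf : ¬ FiniteDimensional ℂ (TwistedHV.weightSpace M lam)) :
    TwistedHV.supp M = {μ : ℂ | ∃ k : ℤ, μ = lam + (k : ℂ)} ∧
      ∀ k : ℤ, ¬ FiniteDimensional ℂ (TwistedHV.weightSpace M (lam + (k : ℂ))) := by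
  have hmem : ∀ z ∈ ({.L 0, .I 0, .C, .CLI, .CI} : Set TwistedHV), z ∈ TwistedHV.cartan :=
    fun z hz => Submodule.subset_span hz
  obtain ⟨h₀, hI₀⟩ := TwistedHV.exists_smul_of_central (M := M) hwt (hmem (.I 0) (by simp))
    TwistedHV.lie_gen_I_zero
  obtain ⟨c₀, hC⟩ := TwistedHV.exists_smul_of_central (M := M) hwt (hmem .C (by simp))
    TwistedHV.lie_gen_C
  obtain ⟨c₁, hCI⟩ := TwistedHV.exists_smul_of_central (M := M) hwt (hmem .CI (by simp))
    TwistedHV.lie_gen_CI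
  obtain ⟨c₂, hCLI⟩ := TwistedHV.exists_smul_of_central (M := M) hwt (hmem .CLI (by simp))
    TwistedHV.lie_gen_CLI
  have hall : ∀ k : ℤ, ¬ FiniteDimensional ℂ (TwistedHV.weightSpace M (lam + (k : ℂ))) :=
    fun k hk => by
      have : FiniteDimensional ℂ (TwistedHV.weightSpace M (lam + ((0 : ℤ) : ℂ))) :=
        (TwistedHV.toGradedHVModule lam hI₀ hC hCI hCLI).finiteDimensional_of_finiteDimensional
          (j := k) hk 0
      rw [Int.cast_zero, add_zero] at this
      exact hinf this
  have hne : ∀ k : ℤ, TwistedHV.weightSpace M (lam + (k : ℂ)) ≠ ⊥ := fun k h => by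
    refine hall k ?_
    rw [h]
    infer_instance
  refine ⟨Set.Subset.antisymm (fun μ hμ => ?_) ?_, hall⟩
  · by_contra hμ'
    have htop : ⨆ k : ℤ, TwistedHV.weightSpace M (lam + (k : ℂ)) = ⊤ :=
      TwistedHV.iSup_eq_top_of_gradedStable hC hCI hCLI
        (fun n k x hx => TwistedHV.L_lie_mem_weightSpace (by push_cast; ring) hx)
        (fun n k x hx => TwistedHV.I_lie_mem_weightSpace (by push_cast; ring) hx) ⟨0, hne 0⟩
    -- The eigenspace for `μ` would be independent of a family that spans the module.
    have hle : ⨆ k : ℤ, TwistedHV.weightSpace M (lam + (k : ℂ)) ≤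
        ⨆ ν ≠ μ, TwistedHV.weightSpace M ν :=
      iSup_le fun k => le_iSup₂_of_le (lam + (k : ℂ)) (fun h => hμ' ⟨k, h.symm⟩) le_rfl
    rw [htop, top_le_iff] at hle
    have hdisj := TwistedHV.iSupIndep_weightSpace (M := M) μ
    rw [hle, disjoint_top] at hdisj
    exact hμ hdisj
  · rintro _ ⟨k, rfl⟩
    exact hne k
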